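/- Let $M=\ell^\infty(\mathbb Z,\mathbb R)\times\ell^\infty(\mathbb Z,\mathbb R)$ with norm $\|(a,b)\|_M=\max(\|a\|_\infty,\|b\|_\infty)$. For every ${\rm x}\in M$ the Toda equations in Flaschka variables $$\dot a_n(t)=a_n(t)\big(b_{n+1}(t)-b_n(t)\big),\qquad \dot b_n(t)=2\big(a_n(t)^2-a_{n-1}(t)^2\big),\qquad n\in\mathbb Z,$$ have a unique solution $t\mapsto\Phi_t({\rm x})=\{(a_n(t),b_n(t))\}_{n\in\mathbb Z}$ that is defined for all $t\in\mathbb R$, is differentiable as a map $\mathbb R\to M$, and satisfies $\Phi_0({\rm x})={\rm x}$. Let $L({\rm x})$ be the bounded Jacobi operator on $\ell^2(\mathbb Z)$ given by $$[L({\rm x})f]_n=a_nf_{n+1}+a_{n-1}f_{n-1}+b_nf_n ,\qquad {\rm x}=\{(a_n,b_n)\}_{n\in\mathbb Z},$$ and let $\|L({\rm x})\|_2$ be its operator norm. Let ${\rm x}\in M$ and $\mu>0$. There exists a number $v=v(\mu,{\rm x})$ such that for all $n,m\in\mathbb Z$, all $t\in\mathbb R$ and each $z\in\{a_m,b_m\}$,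 the partial derivatives of $a_n(t)$ and $b_n(t)$ with respect to the coordinate $z$ of the initial condition exist at ${\rm x}$ and satisfy $$\max\left[\,\left|\frac{\partial}{\partial z}a_n(t)\right|,\ \left|\frac{\partial}{\partial z}b_n(t)\right|\,\right]\le\frac{8}{\sqrt{17}}\,e^{-\mu\left(|n-m|-v|t|\right)} .$$ In fact, one may take $$v=\left(1+\sqrt{17}\right)\|L({\rm x})\|_2\left(e^{\mu+1}+\frac1\mu\right).$$ -/

import Mathlib

open scoped ENNReal

noncomputable section

namespace Toda

/-- Bounded real-valued sequences indexed by `ℤ`, with the supremum norm. -/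
abbrev SeqSpace : Type := lp (fun _ : ℤ => ℝ) ∞

/-- The phase space `M = ℓ^∞(ℤ, ℝ) × ℓ^∞(ℤ, ℝ)` of pairs `(a, b)` in Flaschka variables,
with the norm `max ‖a‖ ‖b‖`. -/
abbrev PhaseSpace : Type := SeqSpace × SeqSpace

/-- The Hilbert space `ℓ²(ℤ)` of complex square-summable sequences. -/
abbrev HilbertSeq : Type := lp (fun _ : ℤ => ℂ) 2

/-- `t ↦ γ t = (a(t), b(t))` is a global solution of the Toda equations in `M`:
`a_n' = a_n (b_{n+1} - b_n)` and `b_n' = 2 (a_n² - a_{n-1}²)`. -/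
structure IsSolution (γ : ℝ → PhaseSpace) : Prop where
  /-- `γ` is differentiable as a map into the Banach space `M`. -/
  differentiable : Differentiable ℝ γ
  hasDerivAt_a : ∀ (t : ℝ) (n : ℤ),
    HasDerivAt (fun s => (γ s).1 n) ((γ t).1 n * ((γ t).2 (n + 1) - (γ t).2 n)) t
  hasDerivAt_b : ∀ (t : ℝ) (n : ℤ),
    HasDerivAt (fun s => (γ s).2 n) (2 * ((γ t).1 n ^ 2 - (γ t).1 (n - 1) ^ 2)) t

/-- `Φ t x` is the value at time `t` of a solution of the Toda equations with initial
condition `x`. -/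
def IsFlow (Φ : ℝ → PhaseSpace → PhaseSpace) : Prop :=
  ∀ x : PhaseSpace, Φ 0 x = x ∧ IsSolution (fun t => Φ t x)

/-- The coordinate direction of the variable `a_m`. -/
def dirA (m : ℤ) : PhaseSpace := (lp.single ∞ m (1 : ℝ), 0)

/-- The coordinate direction of the variable `b_m`. -/
def dirB (m : ℤ) : PhaseSpace := (0, lp.single ∞ m (1 : ℝ))

theorem memℓp_shift (k : ℤ) (f : HilbertSeq) : Memℓp (fun n : ℤ => f (n + k)) 2 := by
  have h := (memℓp_gen_iff (by norm_num)).1 (lp.memℓp f)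
  exact memℓp_gen ((Equiv.addRight k).summable_iff.2 h)

/-- The shift `(S^k f)_n = f_{n+k}` on `ℓ²(ℤ)`. -/
def shift (k : ℤ) : HilbertSeq →L[ℂ] HilbertSeq :=
  LinearMap.mkContinuous
    { toFun := fun f => ⟨fun n => f (n + k), memℓp_shift k f⟩
      map_add' := fun _ _ => rfl
      map_smul' := fun _ _ => rfl }
    1 fun f => by
      rw [one_mul]
      refine lp.norm_le_of_tsum_le (by norm_num) (norm_nonneg _) ?_
      rw [lp.norm_rpow_eq_tsum (by norm_num) f]
      exact ((Equiv.addRight k).tsum_eq fun n => ‖f n‖ ^ (2 : ℝ≥0∞).toReal).le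

theorem norm_mul_le_of_bound (c : SeqSpace) (f : HilbertSeq) (n : ℤ) :
    ‖(c n : ℂ) * f n‖ ≤ ‖((‖c‖ : ℂ) • f) n‖ := by
  change ‖(c n : ℂ) * f n‖ ≤ ‖(‖c‖ : ℂ) * f n‖
  rw [norm_mul, norm_mul, Complex.norm_real, Complex.norm_real, norm_norm]
  exact mul_le_mul_of_nonneg_right (lp.norm_apply_le_norm ENNReal.top_ne_zero c n)
    (norm_nonneg (f n))

theorem memℓp_mul (c : SeqSpace) (f : HilbertSeq) : Memℓp (fun n : ℤ => (c n : ℂ) * f n) 2 := by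
  have h := (lp.memℓp ((‖c‖ : ℂ) • f))
  rw [memℓp_gen_iff (by norm_num)] at h
  refine memℓp_gen (h.of_nonneg_of_le (fun n => by positivity) fun n => ?_)
  gcongr
  exact norm_mul_le_of_bound c f n

/-- Multiplication `f ↦ (c_n f_n)_n` by a bounded real sequence on `ℓ²(ℤ)`. -/
def mulOp (c : SeqSpace) : HilbertSeq →L[ℂ] HilbertSeq :=
  LinearMap.mkContinuous
    { toFun := fun f => ⟨fun n => (c n : ℂ) * f n, memℓp_mul c f⟩
      map_add' := fun f g => lp.ext (funext fun n => mul_add (c n : ℂ) (f n) (g n))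
      map_smul' := fun r f => lp.ext (funext fun n => mul_left_comm (c n : ℂ) r (f n)) }
    ‖c‖ fun f => by
      have h : ‖((‖c‖ : ℂ) • f)‖ = ‖c‖ * ‖f‖ := by
        rw [norm_smul]; simp
      rw [← h]
      refine lp.norm_mono (by norm_num) fun n => ?_
      exact norm_mul_le_of_bound c f n

/-- The Jacobi (Lax) operator `L(x)` on `ℓ²(ℤ)`; its action on sequences is `jacobi_apply`. -/
def jacobi (x : PhaseSpace) : HilbertSeq →L[ℂ] HilbertSeq :=
  mulOp x.1 ∘L shift 1 + shift (-1) ∘L mulOp x.1 + mulOp x.2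

/-- `[L(x) f]_n = a_n f_{n+1} + a_{n-1} f_{n-1} + b_n f_n`. -/
theorem jacobi_apply (x : PhaseSpace) (f : HilbertSeq) (n : ℤ) :
    jacobi x f n = (x.1 n : ℂ) * f (n + 1) + (x.1 (n - 1) : ℂ) * f (n - 1) + (x.2 n : ℂ) * f n :=
  rfl

end Toda

end

/-! The Toda equations are a Lax equation L' = [P, L] with P skew-adjoint (`jacobi_field`), so ‖L‖
never exceeds its value at time 0, forwards or backwards (`norm_le_norm_zero_of_lax`). The
coefficients are matrix entries of L, hence every solution stays in the ball of radius ‖L(x)‖. This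
a priori bound gives global existence and supplies the time-independent constant in every Grönwall
estimate.

The vector field is quadratic, so the difference of two solutions satisfies exactly a linear
nearest-neighbour equation y' = `polar` u y, with u their midpoint (`field_sub_field`). In the sup
norm, Grönwall yields uniqueness and Lipschitz dependence. Applied to the difference of two
difference quotients, it shows that they are Cauchy, so directional derivatives exist without
solving the linearized equation.

In a norm weighted by a truncation of exp(μ|n - m|), a shift by one site costs a factor exp μ, so
the growth rate is K (ratio + 1)(1 + exp μ) (`norm_weighting_polar_le`). A perturbation of size h at
m has weighted size at most |h|. Reading the solution at n gains exp(-μ|n - m|), and dividing by h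
and letting h → 0 bounds the derivative. Elementary inequalities (`ratio_le`, `rate_le`) convert the
constants. -/

open scoped ENNReal

noncomputable section

namespace Toda

open Filter Set Topology

/-! ### Grönwall estimate in both time directions -/

/-- Two-sided Grönwall inequality on a symmetric interval. -/
theorem norm_le_gronwallBound_abs {E : Type*} [NormedAddCommGroup E] [NormedSpace ℝ E]
    {f f' : ℝ → E} {C ε T : ℝ} (hf : ∀ s ∈ Ioo (-T) T, HasDerivAt f (f' s) s)
    (hbound : ∀ s ∈ Ioo (-T) T, ‖f' s‖ ≤ C * ‖f s‖ + ε) {t : ℝ} (ht : t ∈ Ioo (-T) T) :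
    ‖f t‖ ≤ gronwallBound ‖f 0‖ C ε |t| := by
  have key : ∀ (g g' : ℝ → E), (∀ s ∈ Ioo (-T) T, HasDerivAt g (g' s) s) →
      (∀ s ∈ Ioo (-T) T, ‖g' s‖ ≤ C * ‖g s‖ + ε) → ∀ u, 0 ≤ u → u < T →
      ‖g u‖ ≤ gronwallBound ‖g 0‖ C ε u := by
    intro g g' hg hb u hu huT
    have hsub : ∀ s ∈ Icc 0 u, s ∈ Ioo (-T) T := fun s hs =>
      ⟨by linarith [hs.1], by linarith [hs.2]⟩
    have := norm_le_gronwallBound_of_norm_deriv_right_le (f := g) (f' := g') (δ := ‖g 0‖) (K := C)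
      (ε := ε) (a := 0) (b := u)
      (fun s hs => (hg s (hsub s hs)).continuousAt.continuousWithinAt)
      (fun s hs => (hg s (hsub s (Ico_subset_Icc_self hs))).hasDerivWithinAt) le_rfl
      (fun s hs => hb s (hsub s (Ico_subset_Icc_self hs))) u ⟨hu, le_rfl⟩
    simpa using this
  rcases le_total 0 t with h | h
  · rw [abs_of_nonneg h]
    exact key f f' hf hbound t h ht.2
  · rw [abs_of_nonpos h]
    have hneg : ∀ s ∈ Ioo (-T) T, -s ∈ Ioo (-T) T := fun s hs =>
      ⟨by linarith [hs.2], by linarith [hs.1]⟩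
    have := key (fun s => f (-s)) (fun s => -f' (-s))
      (fun s hs => by
        simpa [Function.comp_def] using (hf _ (hneg s hs)).scomp s (hasDerivAt_neg s))
      (fun s hs => by simpa using hbound _ (hneg s hs)) (-t) (by linarith) (by linarith [ht.1])
    simpa using this

/-! ### Norm bound for Lax equations in C*-algebras -/

section CStar

variable {A : Type*} [NormedRing A] [StarRing A] [CStarRing A] [NormedAlgebra ℝ A]
  [StarModule ℝ A]

/-- Skewness cancels the first-order term of star (1 + hp) (1 + hp), so by the C*-identity 1 + hp is
an isometry up to O(h²). -/
theorem norm_one_add_smul_sq_le {p : A} (hp : star p = -p) (h : ℝ) (h1 : ‖(1 : A)‖ ≤ 1) :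
    ‖1 + h • p‖ ^ 2 ≤ 1 + h ^ 2 * ‖p‖ ^ 2 := by
  have e : star (1 + h • p) * (1 + h • p) = 1 - (h ^ 2) • (p * p) := by
    simp only [star_add, star_one, star_smul, hp, star_trivial]
    simp only [smul_neg, add_mul, mul_add, one_mul, mul_one, neg_mul, smul_mul_smul_comm, pow_two]
    abel
  rw [sq, ← CStarRing.norm_star_mul_self, e]
  refine (norm_sub_le _ _).trans ?_
  rw [norm_smul, Real.norm_of_nonneg (sq_nonneg h)]
  have := norm_mul_le p p
  nlinarith [sq_nonneg h]

/-- A Lax equation `L' = [P, L]` with skew-adjoint `P` does not increase the norm of `L`. -/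
theorem norm_le_norm_zero_of_lax {L P : ℝ → A} {T : ℝ} (h1 : ‖(1 : A)‖ ≤ 1)
    (hP : ∀ s, star (P s) = -P s)
    (hL : ∀ s ∈ Ioo (-T) T, HasDerivAt L (P s * L s - L s * P s) s) {t : ℝ}
    (ht : t ∈ Ioo (-T) T) : ‖L t‖ ≤ ‖L 0‖ := by
  have key : ∀ (L P : ℝ → A), (∀ s, star (P s) = -P s) →
      (∀ s ∈ Ioo (-T) T, HasDerivAt L (P s * L s - L s * P s) s) → ∀ u, 0 ≤ u → u < T →
      ‖L u‖ ≤ ‖L 0‖ := by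
    intro L P hP hL u hu huT
    have hsub : ∀ s ∈ Icc 0 u, s ∈ Ioo (-T) T := fun s hs =>
      ⟨by linarith [hs.1], by linarith [hs.2]⟩
    refine image_le_of_liminf_slope_right_le_deriv_boundary (f := fun s => ‖L s‖) (a := 0) (b := u)
      (B := fun _ => ‖L 0‖) (B' := fun _ => 0)
      (fun s hs => (hL s (hsub s hs)).continuousAt.continuousWithinAt.norm) le_rfl
      continuousOn_const (fun s _ => hasDerivWithinAt_const _ _ _) ?_ ⟨hu, le_rfl⟩
    intro s hs r hr
    have hd := hL s (hsub s (Ico_subset_Icc_self hs))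
    set p := P s
    set l := L s
    -- Near s the solution is compared with an almost unitary conjugation of l. It has the same
    -- first-order part as L, and its norm exceeds ‖l‖ only to second order, so no unitary
    -- propagator is needed.
    have hd2 : HasDerivAt (fun z => (1 + (z - s) • p) * l * (1 - (z - s) • p))
        (p * l - l * p) s := by
      have hz : HasDerivAt (fun z : ℝ => (z - s) • p) p s := by
        simpa using ((hasDerivAt_id s).sub_const s).smul_const p
      have := ((hz.const_add 1).mul_const l).mul (hz.const_sub 1)
      refine this.congr_deriv ?_
      simp [sub_eq_add_neg]
    have ho := (hd.sub hd2).isLittleO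
    have hbd : ∀ z, ‖(1 + (z - s) • p) * l * (1 - (z - s) • p)‖
        ≤ (1 + (z - s) ^ 2 * ‖p‖ ^ 2) * ‖l‖ := by
      intro z
      have a1 := norm_one_add_smul_sq_le (hP s) (z - s) h1
      have a2 := norm_one_add_smul_sq_le (hP s) (-(z - s)) h1
      rw [neg_smul, ← sub_eq_add_neg, neg_sq] at a2
      -- Both squares have the same bound, so 2xy ≤ x² + y² bounds the product.
      have a3 : ‖1 + (z - s) • p‖ * ‖1 - (z - s) • p‖ ≤ 1 + (z - s) ^ 2 * ‖p‖ ^ 2 := by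
        nlinarith [sq_nonneg (‖1 + (z - s) • p‖ - ‖1 - (z - s) • p‖)]
      calc _ ≤ ‖1 + (z - s) • p‖ * ‖l‖ * ‖1 - (z - s) • p‖ :=
            (norm_mul_le _ _).trans (by gcongr; exact norm_mul_le _ _)
        _ = (‖1 + (z - s) • p‖ * ‖1 - (z - s) • p‖) * ‖l‖ := by ring
        _ ≤ _ := by gcongr
    have ho' : ∀ᶠ z in 𝓝[>] s, ‖L z - (1 + (z - s) • p) * l * (1 - (z - s) • p)‖
        ≤ r / 2 * ‖z - s‖ := by
      filter_upwards [(ho.def (half_pos hr)).filter_mono nhdsWithin_le_nhds] with z hz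
      simpa [l] using hz
    have hq : ∀ᶠ z in 𝓝[>] s, (z - s) * (‖p‖ ^ 2 * ‖l‖) < r / 2 := by
      have : Tendsto (fun z => (z - s) * (‖p‖ ^ 2 * ‖l‖)) (𝓝 s) (𝓝 ((s - s) * (‖p‖ ^ 2 * ‖l‖))) :=
        (Continuous.tendsto (by fun_prop) s)
      rw [sub_self, zero_mul] at this
      exact (this.eventually_lt_const (half_pos hr)).filter_mono nhdsWithin_le_nhds
    refine Eventually.frequently ?_
    filter_upwards [ho', hq, self_mem_nhdsWithin] with z hz1 hz2 hz3
    have hpos : 0 < z - s := sub_pos.2 hz3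
    rw [slope_def_field, div_lt_iff₀ hpos]
    rw [Real.norm_of_nonneg hpos.le] at hz1
    have := norm_sub_norm_le (L z) ((1 + (z - s) • p) * l * (1 - (z - s) • p))
    have := hbd z
    change ‖L z‖ - ‖l‖ < _
    nlinarith
  rcases le_total 0 t with h | h
  · exact key L P hP hL t h ht.2
  -- Time reversal replaces P by -P(-s), which is again skew-adjoint.
  · have := key (fun s => L (-s)) (fun s => -P (-s)) (fun s => by simp [hP])
      (fun s hs => by
        have := (hL (-s) ⟨by linarith [hs.2], by linarith [hs.1]⟩).scomp s (hasDerivAt_neg s)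
        convert! this using 1
        simp; abel) (-t) (by linarith) (by linarith [ht.1])
    simpa using this

end CStar

/-- Bounded operators on `ℓ²(ℤ)`. -/
abbrev BddOp := HilbertSeq →L[ℂ] HilbertSeq

instance : StarModule ℝ BddOp where
  star_smul r p := by
    have : r • p = (r : ℂ) • p := rfl
    rw [this, star_smul, star_trivial r]
    change star (r : ℂ) • star p = (r : ℂ) • star p
    rw [Complex.star_def, Complex.conj_ofReal]

/-! ### The Toda vector field and its polarization -/

theorem memℓp_seqShift (k : ℤ) (f : SeqSpace) : Memℓp (fun n : ℤ => f (n + k)) ∞ :=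
  memℓp_infty ⟨‖f‖, by rintro _ ⟨n, rfl⟩; exact lp.norm_apply_le_norm ENNReal.top_ne_zero f _⟩

/-- The shift `(S^k f)_n = f_{n+k}` on bounded sequences. -/
def seqShift (k : ℤ) : SeqSpace →L[ℝ] SeqSpace :=
  LinearMap.mkContinuous
    { toFun := fun f => ⟨fun n => f (n + k), memℓp_seqShift k f⟩
      map_add' := fun _ _ => rfl
      map_smul' := fun _ _ => rfl }
    1 fun f => by
      rw [one_mul]
      exact lp.norm_le_of_forall_le (norm_nonneg _) fun n =>
        lp.norm_apply_le_norm ENNReal.top_ne_zero f _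

theorem norm_seqShift_le (k : ℤ) (f : SeqSpace) : ‖seqShift k f‖ ≤ ‖f‖ :=
  lp.norm_le_of_forall_le (norm_nonneg _) fun _ => lp.norm_apply_le_norm ENNReal.top_ne_zero f _

/-- The symmetric bilinear map that polarizes the quadratic Toda vector field:
`field x - field y = polar ((x + y) / 2) (x - y)`. -/
def polar (u y : PhaseSpace) : PhaseSpace :=
  (u.1 * (seqShift 1 y.2 - y.2) + (seqShift 1 u.2 - u.2) * y.1,
    (4 : ℝ) • (u.1 * y.1 - seqShift (-1) (u.1 * y.1)))

/-- The Toda vector field. -/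
def field (x : PhaseSpace) : PhaseSpace := (2⁻¹ : ℝ) • polar x x

theorem polar_fst_apply (u y : PhaseSpace) (n : ℤ) : (polar u y).1 n =
    u.1 n * (y.2 (n + 1) - y.2 n) + (u.2 (n + 1) - u.2 n) * y.1 n := rfl

theorem polar_snd_apply (u y : PhaseSpace) (n : ℤ) : (polar u y).2 n =
    4 * (u.1 n * y.1 n - u.1 (n - 1) * y.1 (n - 1)) := rfl

theorem field_fst_apply (x : PhaseSpace) (n : ℤ) :
    (field x).1 n = x.1 n * (x.2 (n + 1) - x.2 n) := by
  change 2⁻¹ * (polar x x).1 n = _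
  rw [polar_fst_apply]; ring

theorem field_snd_apply (x : PhaseSpace) (n : ℤ) :
    (field x).2 n = 2 * (x.1 n ^ 2 - x.1 (n - 1) ^ 2) := by
  change 2⁻¹ * (polar x x).2 n = _
  rw [polar_snd_apply]; ring

theorem phase_ext {x y : PhaseSpace} (h1 : ∀ n, x.1 n = y.1 n) (h2 : ∀ n, x.2 n = y.2 n) : x = y :=
  Prod.ext (lp.ext (funext h1)) (lp.ext (funext h2))

/-- The midpoint form of the mean value theorem is exact for quadratic maps. It turns differences of
solutions into solutions of a linear equation with no remainder. -/
theorem field_sub_field (x y : PhaseSpace) :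
    field x - field y = polar ((2⁻¹ : ℝ) • (x + y)) (x - y) := by
  refine phase_ext (fun n => ?_) (fun n => ?_)
  · change (field x).1 n - (field y).1 n = _
    rw [field_fst_apply, field_fst_apply, polar_fst_apply]
    change _ = (2⁻¹ * (x.1 n + y.1 n)) * ((x.2 (n+1) - y.2 (n+1)) - (x.2 n - y.2 n)) +
      (2⁻¹ * (x.2 (n+1) + y.2 (n+1)) - 2⁻¹ * (x.2 n + y.2 n)) * (x.1 n - y.1 n)
    ring
  · change (field x).2 n - (field y).2 n = _
    rw [field_snd_apply, field_snd_apply, polar_snd_apply]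
    change _ = 4 * ((2⁻¹ * (x.1 n + y.1 n)) * (x.1 n - y.1 n) -
      (2⁻¹ * (x.1 (n-1) + y.1 (n-1))) * (x.1 (n-1) - y.1 (n-1)))
    ring

theorem polar_sub_right (u y z : PhaseSpace) : polar u (y - z) = polar u y - polar u z := by
  refine phase_ext (fun n => ?_) (fun n => ?_)
  · change _ = (polar u y).1 n - (polar u z).1 n
    simp only [polar_fst_apply, Prod.fst_sub, Prod.snd_sub, lp.coeFn_sub, Pi.sub_apply]; ring
  · change _ = (polar u y).2 n - (polar u z).2 n
    simp only [polar_snd_apply, Prod.fst_sub, lp.coeFn_sub, Pi.sub_apply]; ring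

theorem polar_sub_left (u y z : PhaseSpace) : polar (u - y) z = polar u z - polar y z := by
  refine phase_ext (fun n => ?_) (fun n => ?_)
  · change _ = (polar u z).1 n - (polar y z).1 n
    simp only [polar_fst_apply, Prod.fst_sub, Prod.snd_sub, lp.coeFn_sub, Pi.sub_apply]; ring
  · change _ = (polar u z).2 n - (polar y z).2 n
    simp only [polar_snd_apply, Prod.fst_sub, lp.coeFn_sub, Pi.sub_apply]; ring

theorem polar_smul_right (u y : PhaseSpace) (r : ℝ) : polar u (r • y) = r • polar u y := by
  refine phase_ext (fun n => ?_) (fun n => ?_)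
  · change _ = r * (polar u y).1 n
    simp only [polar_fst_apply, Prod.smul_fst, Prod.smul_snd, lp.coeFn_smul, Pi.smul_apply,
      smul_eq_mul]; ring
  · change _ = r * (polar u y).2 n
    simp only [polar_snd_apply, Prod.smul_fst, lp.coeFn_smul, Pi.smul_apply,
      smul_eq_mul]; ring

theorem norm_polar_le (u y : PhaseSpace) : ‖polar u y‖ ≤ 8 * ‖u‖ * ‖y‖ := by
  have hu1 := norm_fst_le u
  have hu2 := norm_snd_le u
  have hy1 := norm_fst_le y
  have hy2 := norm_snd_le y
  have hm : ‖u.1 * y.1‖ ≤ ‖u‖ * ‖y‖ := (norm_mul_le _ _).trans (by gcongr)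
  have hs : ∀ v : SeqSpace, ‖seqShift 1 v - v‖ ≤ 2 * ‖v‖ := fun v =>
    (norm_sub_le _ _).trans (by linarith [norm_seqShift_le 1 v])
  have h0 : 0 ≤ ‖u‖ * ‖y‖ := by positivity
  refine norm_prod_le_iff.2 ⟨?_, ?_⟩
  · have e1 : ‖u.1 * (seqShift 1 y.2 - y.2)‖ ≤ ‖u‖ * (2 * ‖y‖) :=
      (norm_mul_le _ _).trans (by gcongr; exact (hs _).trans (by gcongr))
    have e2 : ‖(seqShift 1 u.2 - u.2) * y.1‖ ≤ (2 * ‖u‖) * ‖y‖ :=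
      (norm_mul_le _ _).trans (by gcongr; exact (hs _).trans (by gcongr))
    refine (norm_add_le _ _).trans ?_
    linarith
  · change ‖(4 : ℝ) • (u.1 * y.1 - seqShift (-1) (u.1 * y.1))‖ ≤ _
    rw [norm_smul, Real.norm_of_nonneg (by norm_num)]
    have := norm_sub_le (u.1 * y.1) (seqShift (-1) (u.1 * y.1))
    have := norm_seqShift_le (-1) (u.1 * y.1)
    linarith

/-! ### The Jacobi operator and the Lax pair -/

theorem norm_mulOp_le (c : SeqSpace) : ‖mulOp c‖ ≤ ‖c‖ :=
  LinearMap.mkContinuous_norm_le _ (norm_nonneg _) _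

theorem norm_shift_le (k : ℤ) : ‖shift k‖ ≤ 1 :=
  LinearMap.mkContinuous_norm_le _ zero_le_one _

theorem norm_jacobi_le (x : PhaseSpace) : ‖jacobi x‖ ≤ 3 * ‖x‖ := by
  have h1 : ‖mulOp x.1‖ ≤ ‖x‖ := (norm_mulOp_le _).trans (norm_fst_le x)
  have h2 : ‖mulOp x.2‖ ≤ ‖x‖ := (norm_mulOp_le _).trans (norm_snd_le x)
  have e1 : ‖mulOp x.1 ∘L shift 1‖ ≤ ‖x‖ * 1 :=
    (ContinuousLinearMap.opNorm_comp_le _ _).trans (by gcongr; exact norm_shift_le 1)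
  have e2 : ‖shift (-1) ∘L mulOp x.1‖ ≤ 1 * ‖x‖ :=
    (ContinuousLinearMap.opNorm_comp_le _ _).trans (by gcongr; exact norm_shift_le (-1))
  unfold jacobi
  refine (norm_add₃_le).trans ?_
  linarith

/-- The Jacobi operator as a bounded real-linear function of its coefficients. -/
def jacobiCLM : PhaseSpace →L[ℝ] BddOp :=
  LinearMap.mkContinuous
    { toFun := jacobi
      map_add' := fun x y => by
        refine ContinuousLinearMap.ext fun f => lp.ext (funext fun n => ?_)
        change jacobi (x + y) f n = jacobi x f n + jacobi y f n
        simp only [jacobi_apply, Prod.fst_add, Prod.snd_add, lp.coeFn_add, Pi.add_apply]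
        push_cast; ring
      map_smul' := fun r x => by
        refine ContinuousLinearMap.ext fun f => lp.ext (funext fun n => ?_)
        change jacobi (r • x) f n = (r : ℂ) * jacobi x f n
        simp only [jacobi_apply, Prod.smul_fst, Prod.smul_snd, lp.coeFn_smul, Pi.smul_apply,
          smul_eq_mul]
        push_cast; ring } 3 norm_jacobi_le

theorem jacobiCLM_apply (x : PhaseSpace) : jacobiCLM x = jacobi x := rfl

/-- The skew-adjoint operator of the Lax pair, `[P f]_n = a_n f_{n+1} - a_{n-1} f_{n-1}`. -/
def laxOp (x : PhaseSpace) : BddOp := mulOp x.1 ∘L shift 1 - shift (-1) ∘L mulOp x.1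

theorem laxOp_apply (x : PhaseSpace) (f : HilbertSeq) (n : ℤ) :
    laxOp x f n = (x.1 n : ℂ) * f (n + 1) - (x.1 (n - 1) : ℂ) * f (n - 1) := rfl

theorem adjoint_mulOp_comp_shift (c : SeqSpace) :
    star (mulOp c ∘L shift 1) = shift (-1) ∘L mulOp c := by
  rw [ContinuousLinearMap.star_eq_adjoint]
  refine ((ContinuousLinearMap.eq_adjoint_iff _ _).2 fun f g => ?_).symm
  rw [lp.inner_eq_tsum, lp.inner_eq_tsum, ← (Equiv.addRight (1 : ℤ)).tsum_eq]
  refine tsum_congr fun n => ?_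
  change inner ℂ ((c (n + 1 + -1) : ℂ) * f (n + 1 + -1)) (g (n + 1)) =
    inner ℂ (f n) ((c n : ℂ) * g (n + 1))
  rw [add_neg_cancel_right]
  simp [mul_left_comm, mul_assoc]

theorem star_laxOp (x : PhaseSpace) : star (laxOp x) = -laxOp x := by
  unfold laxOp
  rw [star_sub, ← adjoint_mulOp_comp_shift, star_star, neg_sub]

/-- In the commutator the terms in f_{n+2} and f_{n-2} cancel, leaving a Jacobi operator whose
coefficients are the Toda right-hand sides. -/
theorem jacobi_field (x : PhaseSpace) :
    jacobi (field x) = laxOp x * jacobi x - jacobi x * laxOp x := by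
  refine ContinuousLinearMap.ext fun f => lp.ext (funext fun n => ?_)
  change _ = laxOp x (jacobi x f) n - jacobi x (laxOp x f) n
  simp only [jacobi_apply, laxOp_apply, field_fst_apply, field_snd_apply, sub_add_cancel,
    add_sub_cancel_right]
  push_cast
  ring

/-- a_n is the matrix entry of L in row n and column n + 1, obtained by testing on a unit vector. -/
theorem abs_fst_le_norm_jacobi (x : PhaseSpace) (n : ℤ) : |x.1 n| ≤ ‖jacobi x‖ := by
  have h := (jacobi x).le_opNorm (lp.single 2 (n + 1) (1 : ℂ))
  rw [lp.norm_single (by norm_num), norm_one, mul_one] at h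
  refine le_trans ?_ ((lp.norm_apply_le_norm (by norm_num) _ n).trans h)
  rw [jacobi_apply, lp.single_apply_self, lp.single_apply_ne _ _ _ (by omega),
    lp.single_apply_ne _ _ _ (by omega)]
  simp

theorem abs_snd_le_norm_jacobi (x : PhaseSpace) (n : ℤ) : |x.2 n| ≤ ‖jacobi x‖ := by
  have h := (jacobi x).le_opNorm (lp.single 2 n (1 : ℂ))
  rw [lp.norm_single (by norm_num), norm_one, mul_one] at h
  refine le_trans ?_ ((lp.norm_apply_le_norm (by norm_num) _ n).trans h)
  rw [jacobi_apply, lp.single_apply_self, lp.single_apply_ne _ _ _ (by omega),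
    lp.single_apply_ne _ _ _ (by omega)]
  simp

theorem norm_le_norm_jacobi (x : PhaseSpace) : ‖x‖ ≤ ‖jacobi x‖ :=
  norm_prod_le_iff.2 ⟨lp.norm_le_of_forall_le (norm_nonneg _) (abs_fst_le_norm_jacobi x),
    lp.norm_le_of_forall_le (norm_nonneg _) (abs_snd_le_norm_jacobi x)⟩

/-- Along any time change of the Toda flow the norm of the Jacobi operator does not increase. -/
theorem norm_jacobi_le_of_hasDerivAt {γ : ℝ → PhaseSpace} {θ : ℝ → ℝ} {T : ℝ}
    (hγ : ∀ s ∈ Ioo (-T) T, HasDerivAt γ (θ s • field (γ s)) s) {t : ℝ} (ht : t ∈ Ioo (-T) T) :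
    ‖jacobi (γ t)‖ ≤ ‖jacobi (γ 0)‖ := by
  -- The scalar θ is absorbed into P, which stays skew-adjoint because θ is real.
  refine norm_le_norm_zero_of_lax (A := BddOp) (L := fun s => jacobi (γ s))
    (P := fun s => θ s • laxOp (γ s)) (T := T) ContinuousLinearMap.norm_id_le (fun s => ?_)
    (fun s hs => ?_) ht
  · rw [star_smul, star_laxOp, star_trivial, smul_neg]
  · have h := jacobiCLM.hasFDerivAt.comp_hasDerivAt s (hγ s hs)
    rw [map_smul, jacobiCLM_apply, jacobi_field] at h
    rw [smul_mul_assoc, mul_smul_comm, ← smul_sub]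
    exact h

/-! ### A priori bounds, uniqueness and Lipschitz dependence -/

/-- `γ` solves the Toda equations on `(-T, T)`. -/
def SolvesOn (γ : ℝ → PhaseSpace) (T : ℝ) : Prop :=
  ∀ s ∈ Ioo (-T) T, HasDerivAt γ (field (γ s)) s

theorem SolvesOn.norm_jacobi_le {γ : ℝ → PhaseSpace} {T : ℝ} (hγ : SolvesOn γ T) {t : ℝ}
    (ht : t ∈ Ioo (-T) T) : ‖jacobi (γ t)‖ ≤ ‖jacobi (γ 0)‖ :=
  norm_jacobi_le_of_hasDerivAt (θ := fun _ => 1) (fun s hs => by simpa using hγ s hs) ht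

theorem SolvesOn.norm_le {γ : ℝ → PhaseSpace} {T : ℝ} (hγ : SolvesOn γ T) {t : ℝ}
    (ht : t ∈ Ioo (-T) T) : ‖γ t‖ ≤ ‖jacobi (γ 0)‖ :=
  (norm_le_norm_jacobi _).trans (hγ.norm_jacobi_le ht)

theorem norm_midpoint_le {E : Type*} [NormedAddCommGroup E] [NormedSpace ℝ E] {x y : E} {K : ℝ}
    (hx : ‖x‖ ≤ K) (hy : ‖y‖ ≤ K) : ‖(2⁻¹ : ℝ) • (x + y)‖ ≤ K := by
  rw [norm_smul, Real.norm_of_nonneg (by norm_num)]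
  linarith [norm_add_le x y]

/-- Solutions depend Lipschitz-continuously on the initial condition. -/
theorem SolvesOn.norm_sub_le {γ η : ℝ → PhaseSpace} {T K : ℝ} (hγ : SolvesOn γ T)
    (hη : SolvesOn η T) (hγK : ‖jacobi (γ 0)‖ ≤ K) (hηK : ‖jacobi (η 0)‖ ≤ K) {t : ℝ}
    (ht : t ∈ Ioo (-T) T) : ‖γ t - η t‖ ≤ ‖γ 0 - η 0‖ * Real.exp (8 * K * |t|) := by
  have := norm_le_gronwallBound_abs (f := fun s => γ s - η s) (C := 8 * K) (ε := 0)
    (fun s hs => (hγ s hs).sub (hη s hs)) (fun s hs => ?_) ht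
  · rwa [gronwallBound_ε0] at this
  · rw [field_sub_field, add_zero]
    refine (norm_polar_le _ _).trans ?_
    gcongr
    exact norm_midpoint_le ((hγ.norm_le hs).trans hγK) ((hη.norm_le hs).trans hηK)

theorem SolvesOn.eq_of_eq_zero {γ η : ℝ → PhaseSpace} {T : ℝ} (hγ : SolvesOn γ T)
    (hη : SolvesOn η T) (h0 : γ 0 = η 0) {t : ℝ} (ht : t ∈ Ioo (-T) T) : γ t = η t := by
  have := hγ.norm_sub_le hη le_rfl (by rw [h0]) ht
  rw [h0, sub_self, norm_zero, zero_mul] at this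
  exact sub_eq_zero.1 (norm_le_zero_iff.1 this)

theorem SolvesOn.mono {γ : ℝ → PhaseSpace} {S T : ℝ} (hγ : SolvesOn γ T) (h : S ≤ T) :
    SolvesOn γ S := fun s hs => hγ s ⟨by linarith [hs.1], by linarith [hs.2]⟩

theorem norm_field_le (x : PhaseSpace) : ‖field x‖ ≤ 4 * ‖x‖ ^ 2 := by
  rw [field, norm_smul, Real.norm_of_nonneg (by norm_num)]
  linarith [norm_polar_le x x]

theorem norm_field_sub_le {x y : PhaseSpace} {R : ℝ} (hx : ‖x‖ ≤ R) (hy : ‖y‖ ≤ R) :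
    ‖field x - field y‖ ≤ 8 * R * ‖x - y‖ := by
  rw [field_sub_field]
  refine (norm_polar_le _ _).trans ?_
  gcongr
  exact norm_midpoint_le hx hy

/-! ### Global existence by cutting off the vector field -/

/-- A Lipschitz cutoff, equal to one for `r ≤ R` and to zero for `R + 1 ≤ r`. -/
def cutoff (R r : ℝ) : ℝ := max 0 (min 1 (R + 1 - r))

theorem cutoff_nonneg (R r : ℝ) : 0 ≤ cutoff R r := le_max_left _ _

theorem cutoff_le_one (R r : ℝ) : cutoff R r ≤ 1 := max_le zero_le_one (min_le_left _ _)

theorem cutoff_eq_one {R r : ℝ} (h : r ≤ R) : cutoff R r = 1 := by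
  rw [cutoff, min_eq_left (by linarith), max_eq_right zero_le_one]

theorem cutoff_eq_zero {R r : ℝ} (h : R + 1 ≤ r) : cutoff R r = 0 :=
  max_eq_left ((min_le_right _ _).trans (by linarith))

theorem abs_cutoff_sub_le (R r s : ℝ) : |cutoff R r - cutoff R s| ≤ |r - s| := by
  unfold cutoff
  refine (abs_max_sub_max_le_max _ _ _ _).trans (max_le (by simp) ?_)
  refine (abs_min_sub_min_le_max _ _ _ _).trans (max_le (by simp) ?_)
  rw [sub_sub_sub_cancel_left, abs_sub_comm]

/-- The Toda vector field, cut off outside a ball. -/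
def cutField (R : ℝ) (x : PhaseSpace) : PhaseSpace := cutoff R ‖x‖ • field x

theorem norm_cutField_le {R : ℝ} (hR : 0 ≤ R) (x : PhaseSpace) :
    ‖cutField R x‖ ≤ 4 * (R + 1) ^ 2 := by
  rw [cutField, norm_smul, Real.norm_of_nonneg (cutoff_nonneg _ _)]
  rcases le_total (R + 1) ‖x‖ with h | h
  · rw [cutoff_eq_zero h, zero_mul]; positivity
  · calc _ ≤ 1 * (4 * ‖x‖ ^ 2) := by
          gcongr
          · exact cutoff_le_one _ _
          · exact norm_field_le x
      _ ≤ _ := by rw [one_mul]; gcongr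

theorem norm_cutField_sub_le (R : ℝ) {x y : PhaseSpace} {A : ℝ} (hx : ‖x‖ ≤ A) (hy : ‖y‖ ≤ A) :
    ‖cutField R x - cutField R y‖ ≤ (4 * A ^ 2 + 8 * A) * ‖x - y‖ := by
  have e : cutField R x - cutField R y = (cutoff R ‖x‖ - cutoff R ‖y‖) • field x +
      cutoff R ‖y‖ • (field x - field y) := by
    simp only [cutField, sub_smul, smul_sub]; abel
  have hA : 0 ≤ A := (norm_nonneg x).trans hx
  rw [e]
  refine (norm_add_le _ _).trans ?_
  rw [norm_smul, norm_smul, Real.norm_of_nonneg (cutoff_nonneg _ _), Real.norm_eq_abs]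
  have h1 : |cutoff R ‖x‖ - cutoff R ‖y‖| * ‖field x‖ ≤ ‖x - y‖ * (4 * A ^ 2) := by
    gcongr
    · exact (abs_cutoff_sub_le _ _ _).trans (abs_norm_sub_norm_le _ _)
    · exact (norm_field_le x).trans (by gcongr)
  have h2 : cutoff R ‖y‖ * ‖field x - field y‖ ≤ 1 * (8 * A * ‖x - y‖) := by
    gcongr
    · exact cutoff_le_one _ _
    · exact norm_field_sub_le hx hy
  linarith

/-- The cut-off field is bounded, so Picard–Lindelöf reaches any prescribed T. Its solution is a
time change of Toda and obeys the Lax bound, hence it never leaves the region where the cutoff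
equals one. -/
theorem exists_solvesOn (x : PhaseSpace) {T : ℝ} (hT : 0 < T) :
    ∃ γ : ℝ → PhaseSpace, γ 0 = x ∧ SolvesOn γ T := by
  set R := ‖jacobi x‖
  have hR : 0 ≤ R := norm_nonneg _
  let B : NNReal := ⟨4 * (R + 1) ^ 2, by positivity⟩
  -- The radius is speed bound times time, so the solution cannot leave the ball before time T.
  let a : NNReal := ⟨4 * (R + 1) ^ 2 * T, by positivity⟩
  let A : ℝ := ‖x‖ + a
  let C : NNReal := ⟨4 * A ^ 2 + 8 * A, by positivity⟩
  have hball : ∀ y ∈ Metric.closedBall x (a : ℝ), ‖y‖ ≤ A := fun y hy => by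
    have := norm_le_norm_add_norm_sub' y x
    rw [mem_closedBall_iff_norm] at hy
    linarith
  have hpl : IsPicardLindelof (fun _ : ℝ => cutField R) (tmin := -T) (tmax := T)
      ⟨0, by constructor <;> linarith⟩ x a 0 B C :=
    { lipschitzOnWith := fun _ _ => LipschitzOnWith.of_dist_le_mul fun y hy z hz => by
        rw [dist_eq_norm, dist_eq_norm]
        exact norm_cutField_sub_le R (hball y hy) (hball z hz)
      continuousOn := fun _ _ => continuousOn_const
      norm_le := fun _ _ y _ => norm_cutField_le hR y
      mul_max_le := by
        simp only [sub_zero, zero_sub, neg_neg, max_self, NNReal.coe_zero]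
        exact le_rfl }
  obtain ⟨γ, h0, hγ⟩ := hpl.exists_eq_forall_mem_Icc_hasDerivWithinAt₀
  have h0' : γ 0 = x := h0
  have hγ' : ∀ s ∈ Ioo (-T) T, HasDerivAt γ (cutoff R ‖γ s‖ • field (γ s)) s := fun s hs =>
    (hγ s (Ioo_subset_Icc_self hs)).hasDerivAt (Icc_mem_nhds hs.1 hs.2)
  refine ⟨γ, h0', fun s hs => ?_⟩
  have hn : ‖γ s‖ ≤ R := (norm_le_norm_jacobi _).trans
    ((norm_jacobi_le_of_hasDerivAt hγ' hs).trans_eq (by rw [h0']))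
  simpa [cutoff_eq_one hn] using hγ' s hs

theorem exists_global_solution (x : PhaseSpace) :
    ∃ γ : ℝ → PhaseSpace, γ 0 = x ∧ ∀ t, HasDerivAt γ (field (γ t)) t := by
  choose γ h0 hγ using fun k : ℕ => exists_solvesOn x (T := (k : ℝ) + 1) (by positivity)
  have hmem : ∀ t : ℝ, t ∈ Ioo (-((⌈|t|⌉₊ : ℝ) + 1)) ((⌈|t|⌉₊ : ℝ) + 1) := fun t => by
    have := Nat.le_ceil |t|
    exact abs_lt.1 (by linarith)
  -- Uniqueness makes the local solutions agree on overlaps. The extra 1 in the interval length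
  -- keeps t interior, so the glued curve equals a single solution near t.
  have hagree : ∀ (k : ℕ) (t : ℝ), t ∈ Ioo (-((k : ℝ) + 1)) ((k : ℝ) + 1) →
      γ ⌈|t|⌉₊ t = γ k t := by
    intro k t ht
    have hm : t ∈ Ioo (-(min ((⌈|t|⌉₊ : ℝ) + 1) ((k : ℝ) + 1)))
        (min ((⌈|t|⌉₊ : ℝ) + 1) ((k : ℝ) + 1)) :=
      abs_lt.1 (lt_min (abs_lt.2 (hmem t)) (abs_lt.2 ht))
    exact ((hγ _).mono (min_le_left _ _)).eq_of_eq_zero ((hγ k).mono (min_le_right _ _))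
      ((h0 _).trans (h0 _).symm) hm
  refine ⟨fun t => γ ⌈|t|⌉₊ t, h0 _, fun t => ?_⟩
  refine (hγ _ t (hmem t)).congr_of_eventuallyEq ?_
  filter_upwards [Ioo_mem_nhds (hmem t).1 (hmem t).2] with s hs
  exact hagree _ s hs

/-! ### From coordinates to the Banach space equation, and the flow -/

/-- Evaluation of a bounded sequence at a site. -/
def evalSeq (n : ℤ) : SeqSpace →L[ℝ] ℝ :=
  LinearMap.mkContinuous
    { toFun := fun f => f n
      map_add' := fun _ _ => rfl
      map_smul' := fun _ _ => rfl }
    1 fun f => by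
      rw [one_mul]
      exact lp.norm_apply_le_norm ENNReal.top_ne_zero f n

theorem hasDerivAt_fst_apply {γ : ℝ → PhaseSpace} {v : PhaseSpace} {t : ℝ}
    (h : HasDerivAt γ v t) (n : ℤ) : HasDerivAt (fun s => (γ s).1 n) (v.1 n) t :=
  ((evalSeq n).comp (ContinuousLinearMap.fst ℝ SeqSpace SeqSpace)).hasFDerivAt.comp_hasDerivAt t h

theorem hasDerivAt_snd_apply {γ : ℝ → PhaseSpace} {v : PhaseSpace} {t : ℝ}
    (h : HasDerivAt γ v t) (n : ℤ) : HasDerivAt (fun s => (γ s).2 n) (v.2 n) t :=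
  ((evalSeq n).comp (ContinuousLinearMap.snd ℝ SeqSpace SeqSpace)).hasFDerivAt.comp_hasDerivAt t h

theorem isSolution_iff {γ : ℝ → PhaseSpace} :
    IsSolution γ ↔ ∀ t, HasDerivAt γ (field (γ t)) t := by
  constructor
  · intro h t
    have hd := (h.differentiable t).hasDerivAt
    convert! hd using 1
    refine phase_ext (fun n => ?_) (fun n => ?_)
    · rw [field_fst_apply]
      exact (h.hasDerivAt_a t n).unique (hasDerivAt_fst_apply hd n)
    · rw [field_snd_apply]
      exact (h.hasDerivAt_b t n).unique (hasDerivAt_snd_apply hd n)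
  · intro h
    refine ⟨fun t => (h t).differentiableAt, fun t n => ?_, fun t n => ?_⟩
    · simpa only [field_fst_apply] using hasDerivAt_fst_apply (h t) n
    · simpa only [field_snd_apply] using hasDerivAt_snd_apply (h t) n

theorem IsFlow.solvesOn {Φ : ℝ → PhaseSpace → PhaseSpace} (hΦ : IsFlow Φ) (x : PhaseSpace)
    (T : ℝ) : SolvesOn (fun t => Φ t x) T :=
  fun s _ => isSolution_iff.1 (hΦ x).2 s

theorem mem_Ioo_abs_add_one (t : ℝ) : t ∈ Ioo (-(|t| + 1)) (|t| + 1) :=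
  abs_lt.1 (by linarith)

theorem existsUnique_flow : ∃! Φ : ℝ → PhaseSpace → PhaseSpace, IsFlow Φ := by
  choose γ h0 hγ using exists_global_solution
  refine ⟨fun t x => γ x t, fun x => ⟨h0 x, isSolution_iff.2 (hγ x)⟩, fun Ψ hΨ => ?_⟩
  funext t x
  exact (hΨ.solvesOn x _).eq_of_eq_zero (fun s _ => hγ x s) ((hΨ x).1.trans (h0 x).symm)
    (mem_Ioo_abs_add_one t)

/-! ### Weighted norms and finite propagation speed -/

/-- The ratio of the weights of the `a`- and `b`-components in the norm used for the propagation
bound. -/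
def ratio : ℝ := (Real.sqrt 17 - 1) / 2

theorem one_le_ratio : 1 ≤ ratio := by
  have : (3 : ℝ) ≤ Real.sqrt 17 := Real.le_sqrt_of_sq_le (by norm_num)
  unfold ratio; linarith

theorem ratio_pos : 0 < ratio := zero_lt_one.trans_le one_le_ratio

/-- This equation balances the growth factors ratio + 1 of the a-equation and 4 / ratio of the
b-equation; it is where √17 comes from. -/
theorem ratio_mul_ratio_add_one : ratio * (ratio + 1) = 4 := by
  have : Real.sqrt 17 * Real.sqrt 17 = 17 := Real.mul_self_sqrt (by norm_num)
  unfold ratio; linarith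

theorem two_mul_ratio_add_one : 2 * (ratio + 1) = 1 + Real.sqrt 17 := by
  unfold ratio; ring

theorem ratio_le : ratio ≤ 8 / Real.sqrt 17 := by
  have h : Real.sqrt 17 * Real.sqrt 17 = 17 := Real.mul_self_sqrt (by norm_num)
  have h1 : (1 : ℝ) ≤ Real.sqrt 17 := Real.le_sqrt_of_sq_le (by norm_num)
  rw [le_div_iff₀ (by linarith)]
  unfold ratio; linarith

/-- Componentwise multiplication by `w` and `ratio⁻¹ w`. -/
def weighting (w : SeqSpace) : PhaseSpace →L[ℝ] PhaseSpace :=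
  (ContinuousLinearMap.mul ℝ SeqSpace w).prodMap
    (ratio⁻¹ • ContinuousLinearMap.mul ℝ SeqSpace w)

theorem weighting_fst_apply (w : SeqSpace) (y : PhaseSpace) (n : ℤ) :
    (weighting w y).1 n = w n * y.1 n := rfl

theorem weighting_snd_apply (w : SeqSpace) (y : PhaseSpace) (n : ℤ) :
    (weighting w y).2 n = ratio⁻¹ * (w n * y.2 n) := rfl

theorem mul_abs_fst_le_norm_weighting {w : SeqSpace} (hw : ∀ n, 0 ≤ w n) (y : PhaseSpace) (n : ℤ) :
    w n * |y.1 n| ≤ ‖weighting w y‖ := by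
  have := (lp.norm_apply_le_norm ENNReal.top_ne_zero (weighting w y).1 n).trans (norm_fst_le _)
  rwa [weighting_fst_apply, Real.norm_eq_abs, abs_mul, abs_of_nonneg (hw n)] at this

theorem mul_abs_snd_le_norm_weighting {w : SeqSpace} (hw : ∀ n, 0 ≤ w n) (y : PhaseSpace) (n : ℤ) :
    w n * |y.2 n| ≤ ratio * ‖weighting w y‖ := by
  have := (lp.norm_apply_le_norm ENNReal.top_ne_zero (weighting w y).2 n).trans (norm_snd_le _)
  rwa [weighting_snd_apply, Real.norm_eq_abs, abs_mul, abs_mul, abs_of_nonneg (hw n),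
    abs_of_pos (inv_pos.2 ratio_pos), inv_mul_le_iff₀ ratio_pos] at this

theorem norm_weighting_le {w : SeqSpace} (hw : ∀ n, 0 ≤ w n) {y : PhaseSpace} {C : ℝ} (hC : 0 ≤ C)
    (h1 : ∀ n, w n * |y.1 n| ≤ C) (h2 : ∀ n, w n * |y.2 n| ≤ ratio * C) : ‖weighting w y‖ ≤ C := by
  refine norm_prod_le_iff.2 ⟨lp.norm_le_of_forall_le hC fun n => ?_,
    lp.norm_le_of_forall_le hC fun n => ?_⟩
  · rw [weighting_fst_apply, Real.norm_eq_abs, abs_mul, abs_of_nonneg (hw n)]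
    exact h1 n
  · rw [weighting_snd_apply, Real.norm_eq_abs, abs_mul, abs_mul, abs_of_nonneg (hw n),
      abs_of_pos (inv_pos.2 ratio_pos), inv_mul_le_iff₀ ratio_pos]
    exact h2 n

/-- Each component couples only to adjacent sites, where moving the weight costs E. -/
theorem norm_weighting_polar_le {w : SeqSpace} {E K : ℝ} (hw : ∀ n, 0 ≤ w n) (hE : 1 ≤ E)
    (hw1 : ∀ n, w n ≤ E * w (n + 1)) (hw2 : ∀ n, w n ≤ E * w (n - 1)) {u : PhaseSpace}
    (hu : ‖u‖ ≤ K) (y : PhaseSpace) :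
    ‖weighting w (polar u y)‖ ≤ K * ((ratio + 1) * (1 + E)) * ‖weighting w y‖ := by
  set N := ‖weighting w y‖
  have hN : 0 ≤ N := norm_nonneg _
  have hK : 0 ≤ K := (norm_nonneg u).trans hu
  have hr := ratio_pos
  have hua : ∀ n, |u.1 n| ≤ K := fun n =>
    (lp.norm_apply_le_norm ENNReal.top_ne_zero u.1 n).trans ((norm_fst_le u).trans hu)
  have hub : ∀ n, |u.2 n| ≤ K := fun n =>
    (lp.norm_apply_le_norm ENNReal.top_ne_zero u.2 n).trans ((norm_snd_le u).trans hu)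
  have ha : ∀ n, w n * |y.1 n| ≤ N := mul_abs_fst_le_norm_weighting hw y
  have hb : ∀ n, w n * |y.2 n| ≤ ratio * N := mul_abs_snd_le_norm_weighting hw y
  have ha' : ∀ n, w n * |y.1 (n - 1)| ≤ E * N := fun n =>
    calc _ ≤ E * w (n - 1) * |y.1 (n - 1)| := by gcongr; exact hw2 n
      _ = E * (w (n - 1) * |y.1 (n - 1)|) := by ring
      _ ≤ _ := mul_le_mul_of_nonneg_left (ha _) (zero_le_one.trans hE)
  have hb' : ∀ n, w n * |y.2 (n + 1)| ≤ E * (ratio * N) := fun n =>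
    calc _ ≤ E * w (n + 1) * |y.2 (n + 1)| := by gcongr; exact hw1 n
      _ = E * (w (n + 1) * |y.2 (n + 1)|) := by ring
      _ ≤ _ := mul_le_mul_of_nonneg_left (hb _) (zero_le_one.trans hE)
  refine norm_weighting_le hw (by positivity) (fun n => ?_) (fun n => ?_)
  · rw [polar_fst_apply]
    have h1 : |u.1 n * (y.2 (n + 1) - y.2 n) + (u.2 (n + 1) - u.2 n) * y.1 n| ≤
        K * (|y.2 (n + 1)| + |y.2 n|) + (K + K) * |y.1 n| := by
      refine (abs_add_le _ _).trans ?_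
      rw [abs_mul, abs_mul]
      gcongr
      · exact hua n
      · exact abs_sub _ _
      · exact (abs_sub _ _).trans (add_le_add (hub _) (hub _))
    calc _ ≤ w n * (K * (|y.2 (n + 1)| + |y.2 n|) + (K + K) * |y.1 n|) := by
          gcongr; exact hw n
      _ = K * (w n * |y.2 (n + 1)| + w n * |y.2 n| + 2 * (w n * |y.1 n|)) := by ring
      _ ≤ K * (E * (ratio * N) + ratio * N + 2 * N) := by
          refine mul_le_mul_of_nonneg_left ?_ hK
          linarith [hb' n, hb n, ha n]
      -- The diagonal term 2N is absorbed into (1 + E)N because E ≥ 1.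
      _ ≤ K * ((ratio + 1) * (1 + E) * N) := by
          gcongr
          nlinarith [mul_le_mul_of_nonneg_right hE hN]
      _ = _ := by ring
  · rw [polar_snd_apply]
    have h1 : |4 * (u.1 n * y.1 n - u.1 (n - 1) * y.1 (n - 1))| ≤
        4 * (K * |y.1 n| + K * |y.1 (n - 1)|) := by
      rw [abs_mul, abs_of_pos (by norm_num : (0 : ℝ) < 4)]
      gcongr
      refine (abs_sub _ _).trans ?_
      rw [abs_mul, abs_mul]
      gcongr <;> exact hua _
    calc _ ≤ w n * (4 * (K * |y.1 n| + K * |y.1 (n - 1)|)) := by gcongr; exact hw n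
      _ = 4 * K * (w n * |y.1 n| + w n * |y.1 (n - 1)|) := by ring
      _ ≤ 4 * K * (N + E * N) :=
          mul_le_mul_of_nonneg_left (add_le_add (ha n) (ha' n)) (by positivity)
      _ = _ := by rw [← ratio_mul_ratio_add_one]; ring

/-- Weighted stability estimate for two solutions of the Toda equations. -/
theorem SolvesOn.norm_weighting_sub_le {γ η : ℝ → PhaseSpace} {T K E : ℝ} (hγ : SolvesOn γ T)
    (hη : SolvesOn η T) (hγK : ‖jacobi (γ 0)‖ ≤ K) (hηK : ‖jacobi (η 0)‖ ≤ K) {w : SeqSpace}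
    (hw : ∀ n, 0 ≤ w n) (hE : 1 ≤ E) (hw1 : ∀ n, w n ≤ E * w (n + 1))
    (hw2 : ∀ n, w n ≤ E * w (n - 1)) {t : ℝ} (ht : t ∈ Ioo (-T) T) :
    ‖weighting w (γ t - η t)‖ ≤
      ‖weighting w (γ 0 - η 0)‖ * Real.exp (K * ((ratio + 1) * (1 + E)) * |t|) := by
  have := norm_le_gronwallBound_abs (f := fun s => weighting w (γ s - η s))
    (C := K * ((ratio + 1) * (1 + E))) (ε := 0)
    (fun s hs => (weighting w).hasFDerivAt.comp_hasDerivAt s ((hγ s hs).sub (hη s hs)))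
    (fun s hs => ?_) ht
  · rwa [gronwallBound_ε0] at this
  · rw [field_sub_field, add_zero]
    exact norm_weighting_polar_le hw hE hw1 hw2
      (norm_midpoint_le ((hγ.norm_le hs).trans hγK) ((hη.norm_le hs).trans hηK)) _

/-- The exponential weight `exp (μ min(|n - m|, J))`. -/
def expWeight (μ : ℝ) (hμ : 0 ≤ μ) (m : ℤ) (J : ℝ) : SeqSpace :=
  ⟨fun n : ℤ => Real.exp (μ * min |(n : ℝ) - m| J), memℓp_infty ⟨Real.exp (μ * J), by
    rintro _ ⟨n, rfl⟩
    dsimp only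
    rw [Real.norm_eq_abs, Real.abs_exp]
    gcongr
    exact min_le_right _ _⟩⟩

theorem expWeight_apply (μ : ℝ) (hμ : 0 ≤ μ) (m : ℤ) (J : ℝ) (n : ℤ) :
    expWeight μ hμ m J n = Real.exp (μ * min |(n : ℝ) - m| J) := rfl

/-- The truncated distance is 1-Lipschitz, so the cost per site is exp μ whatever J is. -/
theorem expWeight_le (μ : ℝ) (hμ : 0 ≤ μ) (m : ℤ) (J : ℝ) {n k : ℤ} (h : |(n : ℝ) - k| ≤ 1) :
    expWeight μ hμ m J n ≤ Real.exp μ * expWeight μ hμ m J k := by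
  rw [expWeight_apply, expWeight_apply, ← Real.exp_add]
  gcongr
  have h1 : |(n : ℝ) - m| ≤ |(k : ℝ) - m| + 1 := by
    have := abs_sub_le (n : ℝ) k m
    linarith
  have h2 : min |(n : ℝ) - m| J ≤ min |(k : ℝ) - m| J + 1 := by
    rw [← min_add_add_right]
    exact min_le_min h1 (by linarith)
  nlinarith

theorem mul_abs_single_le {w : SeqSpace} {m : ℤ} (hw : w m = 1) (h : ℝ) (n : ℤ) :
    w n * |h * lp.single (E := fun _ : ℤ => ℝ) ∞ m (1 : ℝ) n| ≤ |h| := by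
  rcases eq_or_ne n m with rfl | hn
  · rw [lp.single_apply_self, hw, one_mul, mul_one]
  · rw [lp.single_apply_ne _ _ _ hn, mul_zero, abs_zero, mul_zero]
    exact abs_nonneg h

theorem norm_weighting_smul_dir_le {w : SeqSpace} (hw : ∀ n, 0 ≤ w n) {m : ℤ} (hm : w m = 1)
    {z : PhaseSpace} (hz : z ∈ ({dirA m, dirB m} : Set PhaseSpace)) (h : ℝ) :
    ‖weighting w (h • z)‖ ≤ |h| := by
  have hr : |h| ≤ ratio * |h| := le_mul_of_one_le_left (abs_nonneg h) one_le_ratio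
  have h0 : ∀ n, w n * |h * 0| ≤ |h| := fun n => by simp
  rcases hz with rfl | rfl
  · exact norm_weighting_le hw (abs_nonneg h) (mul_abs_single_le hm h)
      (fun n => (h0 n).trans hr)
  · exact norm_weighting_le hw (abs_nonneg h) h0 (fun n => (mul_abs_single_le hm h n).trans hr)

/-- Propagation bound for the difference of two solutions whose initial conditions differ at a
single site. -/
theorem SolvesOn.abs_sub_apply_le {γ η : ℝ → PhaseSpace} {T K μ : ℝ} (hγ : SolvesOn γ T)
    (hη : SolvesOn η T) (hγK : ‖jacobi (γ 0)‖ ≤ K) (hηK : ‖jacobi (η 0)‖ ≤ K) (hμ : 0 ≤ μ) {m : ℤ}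
    {z : PhaseSpace} (hz : z ∈ ({dirA m, dirB m} : Set PhaseSpace)) {h : ℝ}
    (h0 : γ 0 - η 0 = h • z) {t : ℝ} (ht : t ∈ Ioo (-T) T) (n : ℤ) :
    max |(γ t - η t).1 n| |(γ t - η t).2 n| ≤ |h| * (ratio *
      Real.exp (K * ((ratio + 1) * (1 + Real.exp μ)) * |t| - μ * |(n : ℝ) - m|)) := by
  -- Truncating at the distance to the observed site keeps the weight bounded while giving it the
  -- full value exp(μ|n - m|) at n.
  set J := |(n : ℝ) - m|
  set w := expWeight μ hμ m J
  have hw : ∀ n, 0 ≤ w n := fun n => (Real.exp_pos _).le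
  have hwm : w m = 1 := by
    rw [expWeight_apply, sub_self, abs_zero, min_eq_left (abs_nonneg _), mul_zero, Real.exp_zero]
  have hwn : w n = Real.exp (μ * J) := by rw [expWeight_apply, min_self]
  have key := hγ.norm_weighting_sub_le hη hγK hηK hw (Real.one_le_exp hμ)
    (fun n => expWeight_le μ hμ m J (by push_cast; simp))
    (fun n => expWeight_le μ hμ m J (by push_cast; simp)) ht
  rw [h0] at key
  have key2 := key.trans (mul_le_mul_of_nonneg_right (norm_weighting_smul_dir_le hw hwm hz h)
    (Real.exp_pos _).le)
  have e1 := mul_abs_fst_le_norm_weighting hw (γ t - η t) n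
  have e2 := mul_abs_snd_le_norm_weighting hw (γ t - η t) n
  have hr := one_le_ratio
  have e1' := e1.trans (le_mul_of_one_le_left (norm_nonneg _) hr)
  have e3 := mul_le_mul_of_nonneg_left key2 ratio_pos.le
  rw [hwn] at e1' e2
  rw [Real.exp_sub, ← mul_div_assoc, ← mul_div_assoc]
  refine max_le ?_ ?_ <;> rw [le_div_iff₀ (Real.exp_pos _)] <;> linarith

/-! ### Differentiability along lines -/

/-- A function whose difference quotients at `0` satisfy a Cauchy estimate is differentiable. -/
theorem differentiableAt_zero_of_slope {E : Type*} [NormedAddCommGroup E] [NormedSpace ℝ E]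
    [CompleteSpace E] {g : ℝ → E} {C : ℝ}
    (h : ∀ s k : ℝ, s ≠ 0 → k ≠ 0 → |s| ≤ 1 → |k| ≤ 1 →
      ‖slope g 0 s - slope g 0 k‖ ≤ C * |s - k|) : DifferentiableAt ℝ g 0 := by
  have hc : Cauchy (map (slope g 0) (𝓝[≠] 0)) := by
    refine cauchy_map_iff.2 ⟨inferInstance, ?_⟩
    rw [Metric.uniformity_eq_comap_nhds_zero, tendsto_comap_iff]
    have ht : Tendsto (fun p : ℝ × ℝ => C * |p.1 - p.2|) (𝓝[≠] 0 ×ˢ 𝓝[≠] 0) (𝓝 0) := by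
      have : Tendsto (fun p : ℝ × ℝ => C * |p.1 - p.2|) (𝓝 0) (𝓝 (C * |(0 : ℝ) - 0|)) :=
        Continuous.tendsto (by fun_prop) (0 : ℝ × ℝ)
      rw [sub_self, abs_zero, mul_zero] at this
      refine this.mono_left ?_
      rw [← Prod.mk_zero_zero, nhds_prod_eq]
      exact prod_mono nhdsWithin_le_nhds nhdsWithin_le_nhds
    refine squeeze_zero' (Eventually.of_forall fun _ => dist_nonneg) ?_ ht
    have hs : ∀ᶠ s : ℝ in 𝓝[≠] 0, s ≠ 0 ∧ |s| ≤ 1 := by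
      filter_upwards [self_mem_nhdsWithin, nhdsWithin_le_nhds
        (Metric.closedBall_mem_nhds (0 : ℝ) one_pos)] with s h1 h2
      exact ⟨h1, by simpa using h2⟩
    filter_upwards [hs.prod_mk hs] with p hp
    simp only [Function.comp_apply, dist_eq_norm]
    exact h _ _ hp.1.1 hp.2.1 hp.1.2 hp.2.2
  obtain ⟨d, hd⟩ := CompleteSpace.complete hc
  exact (hasDerivAt_iff_tendsto_slope.2 hd).differentiableAt

/-- The Toda flow is differentiable along lines in the phase space. -/
theorem IsFlow.differentiableAt_line {Φ : ℝ → PhaseSpace → PhaseSpace} (hΦ : IsFlow Φ)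
    (x z : PhaseSpace) (t : ℝ) : DifferentiableAt ℝ (fun s : ℝ => Φ t (x + s • z)) 0 := by
  set T := |t| + 1
  set K := 3 * (‖x‖ + ‖z‖)
  have hsol : ∀ s : ℝ, SolvesOn (fun τ => Φ τ (x + s • z)) T := fun s => hΦ.solvesOn _ _
  have h0 : ∀ s : ℝ, Φ 0 (x + s • z) = x + s • z := fun s => (hΦ _).1
  have hK : ∀ s : ℝ, |s| ≤ 1 → ‖jacobi (Φ 0 (x + s • z))‖ ≤ K := fun s hs => by
    rw [h0]
    refine (norm_jacobi_le _).trans ?_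
    have : ‖s • z‖ ≤ 1 * ‖z‖ := by rw [norm_smul]; gcongr; exact hs
    have := norm_add_le x (s • z)
    simp only [K]; linarith
  have hz : |(0 : ℝ)| ≤ 1 := by simp
  have hbd : ∀ s : ℝ, |s| ≤ 1 → ∀ τ ∈ Ioo (-T) T, ‖Φ τ (x + s • z)‖ ≤ K := fun s hs τ hτ =>
    ((hsol s).norm_le hτ).trans (hK s hs)
  have hK0 : 0 ≤ K := by positivity
  set M := ‖z‖ * Real.exp (8 * K * T)
  have hlip : ∀ s k : ℝ, |s| ≤ 1 → |k| ≤ 1 → ∀ τ ∈ Ioo (-T) T,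
      ‖Φ τ (x + s • z) - Φ τ (x + k • z)‖ ≤ |s - k| * M := by
    intro s k hs hk τ hτ
    refine ((hsol s).norm_sub_le (hsol k) (hK s hs) (hK k hk) hτ).trans ?_
    rw [h0, h0, add_sub_add_left_eq_sub, ← sub_smul, norm_smul, Real.norm_eq_abs, mul_assoc]
    have := (abs_lt.2 hτ).le
    simp only [M]
    gcongr
  have hq : ∀ (s τ : ℝ), slope (fun s : ℝ => Φ τ (x + s • z)) 0 s =
      s⁻¹ • (Φ τ (x + s • z) - Φ τ (x + (0 : ℝ) • z)) := fun s τ => by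
    rw [slope_def_module, sub_zero]
  refine differentiableAt_zero_of_slope
    (C := gronwallBound 0 (8 * K) (4 * M * M) |t|) fun s k hs0 hk0 hs hk => ?_
  set q : ℝ → ℝ → PhaseSpace := fun s τ => s⁻¹ • (Φ τ (x + s • z) - Φ τ (x + (0 : ℝ) • z))
  have hqd : ∀ s, ∀ τ ∈ Ioo (-T) T, HasDerivAt (q s)
      (polar ((2⁻¹ : ℝ) • (Φ τ (x + s • z) + Φ τ (x + (0 : ℝ) • z))) (q s τ)) τ := by
    intro s τ hτ
    have := ((hsol s τ hτ).sub (hsol 0 τ hτ)).const_smul s⁻¹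
    rw [field_sub_field, ← polar_smul_right] at this
    exact this
  have hqM : ∀ s, s ≠ 0 → |s| ≤ 1 → ∀ τ ∈ Ioo (-T) T, ‖q s τ‖ ≤ M := by
    intro s hs0 hs τ hτ
    simp only [q]
    rw [norm_smul, norm_inv, Real.norm_eq_abs, inv_mul_le_iff₀ (abs_pos.2 hs0)]
    simpa using hlip s 0 hs hz τ hτ
  have hq0 : ∀ s, s ≠ 0 → q s 0 = z := by
    intro s hs0
    simp only [q]
    rw [h0, h0, add_sub_add_left_eq_sub, ← sub_smul, sub_zero, smul_smul, inv_mul_cancel₀ hs0,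
      one_smul]
  -- Both quotients start at z, so their difference starts at 0. It is driven only by the change of
  -- midpoints, at most |s - k| M / 2, acting on a quotient of size at most M; the factor 8 of
  -- `norm_polar_le` makes this 4 M².
  have key := norm_le_gronwallBound_abs (f := fun τ => q s τ - q k τ) (C := 8 * K)
    (ε := |s - k| * (4 * M * M)) (T := T) (t := t)
    (fun τ hτ => (hqd s τ hτ).sub (hqd k τ hτ)) (fun τ hτ => ?_) (mem_Ioo_abs_add_one t)
  · rw [hq, hq]
    refine key.trans (le_of_eq ?_)
    rw [hq0 s hs0, hq0 k hk0, sub_self, norm_zero]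
    simp only [gronwallBound]
    split_ifs <;> ring
  · set u := fun s : ℝ => (2⁻¹ : ℝ) • (Φ τ (x + s • z) + Φ τ (x + (0 : ℝ) • z)) with hu
    have e : polar (u s) (q s τ) - polar (u k) (q k τ) =
        polar (u s) (q s τ - q k τ) + polar (u s - u k) (q k τ) := by
      rw [polar_sub_right, polar_sub_left]; abel
    change ‖polar (u s) (q s τ) - polar (u k) (q k τ)‖ ≤ 8 * K * ‖q s τ - q k τ‖ + _
    rw [e]
    have h1 : ‖u s‖ ≤ K := norm_midpoint_le (hbd s hs τ hτ) (hbd 0 hz τ hτ)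
    have h2 : ‖u s - u k‖ ≤ 2⁻¹ * (|s - k| * M) := by
      simp only [hu]
      rw [← smul_sub, add_sub_add_right_eq_sub, norm_smul, Real.norm_of_nonneg (by norm_num)]
      gcongr
      exact hlip s k hs hk τ hτ
    refine (norm_add_le _ _).trans (add_le_add ?_ ?_)
    · refine (norm_polar_le _ _).trans ?_
      gcongr
    · calc _ ≤ 8 * ‖u s - u k‖ * ‖q k τ‖ := norm_polar_le _ _
        _ ≤ 8 * (2⁻¹ * (|s - k| * M)) * M := by
            gcongr
            exact hqM k hk0 hk τ hτ
        _ = _ := by ring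

/-! ### The derivative bound and its constants -/

theorem abs_deriv_zero_le {g : ℝ → ℝ} {d : ℝ} {B : ℝ → ℝ} (hg : HasDerivAt g d 0)
    (hB : ContinuousAt B 0) (h : ∀ s, |g s - g 0| ≤ |s| * B s) : |d| ≤ B 0 := by
  have h1 := (hasDerivAt_iff_tendsto_slope.1 hg).abs
  refine le_of_tendsto_of_tendsto h1 (hB.tendsto.mono_left nhdsWithin_le_nhds) ?_
  filter_upwards [self_mem_nhdsWithin] with s hs
  rw [slope_def_field, sub_zero, abs_div, div_le_iff₀ (abs_pos.2 hs), mul_comm]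
  exact h s

/-- Propagation bound for the derivative of the flow in a coordinate direction. -/
theorem IsFlow.abs_lineDeriv_le {Φ : ℝ → PhaseSpace → PhaseSpace} (hΦ : IsFlow Φ) (x : PhaseSpace)
    {μ : ℝ} (hμ : 0 ≤ μ) (n m : ℤ) (t : ℝ) {z : PhaseSpace}
    (hz : z ∈ ({dirA m, dirB m} : Set PhaseSpace)) :
    LineDifferentiableAt ℝ (fun y => (Φ t y).1 n) x z ∧
    LineDifferentiableAt ℝ (fun y => (Φ t y).2 n) x z ∧
    max |lineDeriv ℝ (fun y => (Φ t y).1 n) x z| |lineDeriv ℝ (fun y => (Φ t y).2 n) x z| ≤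
      ratio * Real.exp (‖jacobi x‖ * ((ratio + 1) * (1 + Real.exp μ)) * |t| -
        μ * |(n : ℝ) - m|) := by
  have hd := (hΦ.differentiableAt_line x z t).hasDerivAt
  have hd1 := hasDerivAt_fst_apply hd n
  have hd2 := hasDerivAt_snd_apply hd n
  -- K must dominate both initial operators. Its continuity in s lets the limit s → 0 recover
  -- exactly ‖L(x)‖.
  set K : ℝ → ℝ := fun s => max ‖jacobiCLM (x + s • z)‖ ‖jacobiCLM (x + (0 : ℝ) • z)‖
  set B : ℝ → ℝ := fun s => ratio * Real.exp (K s * ((ratio + 1) * (1 + Real.exp μ)) * |t| -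
    μ * |(n : ℝ) - m|)
  have hB : Continuous B := by fun_prop
  have hB0 : B 0 = ratio * Real.exp (‖jacobi x‖ * ((ratio + 1) * (1 + Real.exp μ)) * |t| -
      μ * |(n : ℝ) - m|) := by
    simp only [B, K, max_self, zero_smul, add_zero, jacobiCLM_apply]
  have hbd : ∀ s : ℝ, max |(Φ t (x + s • z) - Φ t (x + (0 : ℝ) • z)).1 n|
      |(Φ t (x + s • z) - Φ t (x + (0 : ℝ) • z)).2 n| ≤ |s| * B s := fun s => by
    refine (hΦ.solvesOn (x + s • z) (|t| + 1)).abs_sub_apply_le (hΦ.solvesOn (x + (0 : ℝ) • z) _)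
      (K := K s) ?_ ?_ hμ hz ?_ (mem_Ioo_abs_add_one t) n
    · rw [(hΦ _).1]; exact le_max_left _ _
    · rw [(hΦ _).1]; exact le_max_right _ _
    · rw [(hΦ _).1, (hΦ _).1, add_sub_add_left_eq_sub, ← sub_smul, sub_zero]
  refine ⟨hd1.differentiableAt, hd2.differentiableAt, ?_⟩
  rw [← hB0]
  refine max_le ?_ ?_
  · rw [lineDeriv, hd1.deriv]
    exact abs_deriv_zero_le hd1 hB.continuousAt fun s => (le_max_left _ _).trans (hbd s)
  · rw [lineDeriv, hd2.deriv]
    exact abs_deriv_zero_le hd2 hB.continuousAt fun s => (le_max_right _ _).trans (hbd s)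

/-- Since 1 + √17 = 2(ratio + 1), this reduces to 1 + exp μ ≤ 2 + 2μ exp(μ + 1), which follows from
exp μ - 1 ≤ μ exp μ, that is, 1 - μ ≤ exp(-μ). -/
theorem rate_le {K μ : ℝ} (hK : 0 ≤ K) (hμ : 0 < μ) :
    K * ((ratio + 1) * (1 + Real.exp μ)) ≤
      μ * ((1 + Real.sqrt 17) * K * (Real.exp (μ + 1) + 1 / μ)) := by
  have h1 : Real.exp μ - 1 ≤ μ * Real.exp μ := by
    have h := Real.add_one_le_exp (-μ)
    have h2 : Real.exp (-μ) * Real.exp μ = 1 := by rw [← Real.exp_add]; simp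
    nlinarith [Real.exp_pos μ]
  have h2 : Real.exp μ ≤ Real.exp (μ + 1) := Real.exp_le_exp.2 (by linarith)
  have h3 : μ * Real.exp μ ≤ μ * Real.exp (μ + 1) := by gcongr
  have h4 : 0 ≤ μ * Real.exp (μ + 1) := by positivity
  have e : μ * ((1 + Real.sqrt 17) * K * (Real.exp (μ + 1) + 1 / μ)) =
      K * ((ratio + 1) * (2 * (μ * Real.exp (μ + 1)) + 2)) := by
    rw [← two_mul_ratio_add_one]; field_simp
  rw [e]
  have hr := ratio_pos
  refine mul_le_mul_of_nonneg_left (mul_le_mul_of_nonneg_left ?_ (by linarith)) hK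
  linarith

end Toda

end

theorem mainTheorem1 :
    (∃! Φ : ℝ → Toda.PhaseSpace → Toda.PhaseSpace, Toda.IsFlow Φ) ∧
    ∀ Φ : ℝ → Toda.PhaseSpace → Toda.PhaseSpace, Toda.IsFlow Φ →
      ∀ (x : Toda.PhaseSpace) (μ : ℝ), 0 < μ →
        ∃ v : ℝ, v = (1 + Real.sqrt 17) * ‖Toda.jacobi x‖ * (Real.exp (μ + 1) + 1 / μ) ∧
          ∀ (n m : ℤ) (t : ℝ), ∀ z ∈ ({Toda.dirA m, Toda.dirB m} : Set Toda.PhaseSpace),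
            LineDifferentiableAt ℝ (fun y => (Φ t y).1 n) x z ∧
            LineDifferentiableAt ℝ (fun y => (Φ t y).2 n) x z ∧
            max |lineDeriv ℝ (fun y => (Φ t y).1 n) x z|
                |lineDeriv ℝ (fun y => (Φ t y).2 n) x z| ≤
              8 / Real.sqrt 17 * Real.exp (-μ * (|(n : ℝ) - (m : ℝ)| - v * |t|)) := by
  refine ⟨Toda.existsUnique_flow, fun Φ hΦ x μ hμ => ⟨_, rfl, fun n m t z hz => ?_⟩⟩
  obtain ⟨h1, h2, h3⟩ := hΦ.abs_lineDeriv_le x hμ.le n m t hz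
  refine ⟨h1, h2, h3.trans ?_⟩
  have hr := Toda.ratio_pos
  have hrate := mul_le_mul_of_nonneg_right (Toda.rate_le (norm_nonneg (Toda.jacobi x)) hμ)
    (abs_nonneg t)
  gcongr
  · exact Toda.ratio_le
  · linarith
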